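/- Let $p$ be a prime number. A cyclotomic pro-$p$ pair is a pair $\mathcal G=(G,\theta)$ consisting of a pro-$p$ group $G$ and a continuous homomorphism $\theta\colon G\to 1+p\mathbb Z_p$. Write $H^i(G)=H^i(G,\mathbb Z/p)$ for profinite cohomology with trivial action, and identify $H^1(G)$ with the group of continuous homomorphisms $G\to\mathbb Z/p$. Let $\varepsilon_{\mathcal G}\in H^1(G)$ be $0$ if $p>2$, and if $p=2$ let it be the composition of $\theta$ with the projection $\mathbb Z_2^\times=\{\pm1\}\times(1+4\mathbb Z_2)\to\{\pm1\}\cong\mathbb Z/2$. Let $\bar{\mathcal G}=(\bar G,\bar\theta)$ be a cyclotomic pro-$p$ pair and let $A=\mathbb Z_p^m$ for an arbitrary cardinal number $m$, with the product topology. Let $\mathcal G=(G,\theta)=A\rtimes\bar{\mathcal G}$ be the extension of $\bar{\mathcal G}$ by $A$: thus $G=A\rtimes\bar G$ with $\bar g a\bar g^{-1}=\bar\theta(\bar g)a$ for $\bar g\in\bar G$, $a\in A$ (with $A$ written additively), and $\theta=\bar\theta\circ\pi$, where $\pi\colon G\to\bar G$ is the projection. Let $\inf\colon H^1(\bar G)\to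 H^1(G)$ be the inflation along $\pi$. Then every $\varphi\in H^1(G)\setminus\inf(H^1(\bar G))$ is rigid with respect to the cup product $\cup\colon H^1(G)\times H^1(G)\to H^2(G)$ with distinguished element $\varepsilon_{\mathcal G}$; that is, $\varphi\ne0$, and whenever $\psi\in H^1(G)$ satisfies $\varphi\cup\psi=0$, the elements $\varepsilon_{\mathcal G}+\varphi$ and $\psi$ are $\mathbb F_p$-linearly dependent. More precisely, $\psi$ is then an $\mathbb F_p$-multiple of $\varphi+\varepsilon_{\mathcal G}$. -/

import Mathlib

universe u v

/-! ### Cohomology in degrees one and two with trivial coefficients `ℤ/p`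

For a topological group `G`, the complex of continuous inhomogeneous cochains
`C^n(G) = C(G^n, ℤ/p)` with trivial action on `ℤ/p`. -/

section Cohomology

variable (p : ℕ) (G : Type u) [Group G] [TopologicalSpace G]

/-- `H^1(G) = H^1(G, ℤ/p)`: the continuous homomorphisms `G → ℤ/p`, an `𝔽_p`-linear space
(the `1`-cocycles; the `1`-coboundaries vanish because the action is trivial). -/
def H1 : Submodule (ZMod p) C(G, ZMod p) where
  carrier := {f | ∀ g h : G, f (g * h) = f g + f h}
  add_mem' := by
    intro a b ha hb g h
    simp only [ContinuousMap.add_apply, ha g h, hb g h]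
    ring
  zero_mem' := by
    intro g h
    simp
  smul_mem' := by
    intro c a ha g h
    simp only [ContinuousMap.smul_apply, ha g h, smul_add]

/-- Continuous inhomogeneous `2`-cocycles `G × G → ℤ/p`. -/
def Z2 : Submodule (ZMod p) C(G × G, ZMod p) where
  carrier := {f | ∀ g h k : G, f (h, k) - f (g * h, k) + f (g, h * k) - f (g, h) = 0}
  add_mem' := by
    intro a b ha hb g h k
    have h1 := ha g h k
    have h2 := hb g h k
    simp only [ContinuousMap.add_apply]
    linear_combination h1 + h2
  zero_mem' := by
    intro g h k
    simp
  smul_mem' := by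
    intro c a ha g h k
    have h1 := ha g h k
    simp only [ContinuousMap.smul_apply, smul_eq_mul]
    linear_combination c * h1

variable [IsTopologicalGroup G]

/-- The differential `C^1(G) → Z^2(G)`, `(d c)(g, h) = c(h) - c(gh) + c(g)`. -/
def d12 : C(G, ZMod p) →ₗ[ZMod p] Z2 p G where
  toFun c := ⟨⟨fun x => c x.2 - c (x.1 * x.2) + c x.1, by fun_prop⟩, by
    intro g h k
    simp only [ContinuousMap.coe_mk, mul_assoc]
    ring⟩
  map_add' a b := by
    ext x
    simp only [ContinuousMap.coe_mk, ContinuousMap.add_apply, Submodule.coe_add]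
    ring
  map_smul' c a := by
    ext x
    simp only [ContinuousMap.coe_mk, ContinuousMap.smul_apply, smul_eq_mul, RingHom.id_apply,
      SetLike.val_smul]
    ring

/-- `H^2(G) = H^2(G, ℤ/p)`: continuous `2`-cocycles modulo coboundaries of continuous
`1`-cochains. -/
abbrev H2 : Type u := Z2 p G ⧸ LinearMap.range (d12 p G)

/-- The cup product on cocycles: `(φ ∪ ψ)(g, h) = φ(g) ψ(h)`. -/
def cupCocycle (φ ψ : H1 p G) : Z2 p G :=
  ⟨⟨fun x => φ.1 x.1 * ψ.1 x.2, by fun_prop⟩, by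
    intro g h k
    simp only [ContinuousMap.coe_mk, φ.2 g h, ψ.2 h k]
    ring⟩

/-- The cup product `∪ : H^1(G) × H^1(G) → H^2(G)`. -/
def cup : H1 p G →ₗ[ZMod p] H1 p G →ₗ[ZMod p] H2 p G :=
  LinearMap.mk₂ (ZMod p) (fun φ ψ => Submodule.Quotient.mk (cupCocycle p G φ ψ))
    (fun a b c => by
      rw [← Submodule.Quotient.mk_add]
      congr 1
      ext x
      simp [cupCocycle, add_mul])
    (fun r a b => by
      rw [← Submodule.Quotient.mk_smul]
      congr 1
      ext x
      simp [cupCocycle, mul_assoc])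
    (fun a b c => by
      rw [← Submodule.Quotient.mk_add]
      congr 1
      ext x
      simp [cupCocycle, mul_add])
    (fun r a b => by
      rw [← Submodule.Quotient.mk_smul]
      congr 1
      ext x
      simp [cupCocycle, mul_left_comm])

end Cohomology

/-- Inflation `H^1(Q) → H^1(G)` along a continuous homomorphism `π : G → Q`. -/
def inflation (p : ℕ) {G : Type u} [Group G] [TopologicalSpace G] {Q : Type v} [Group Q] [TopologicalSpace Q] (π : G →ₜ* Q) :
    H1 p Q →ₗ[ZMod p] H1 p G where
  toFun f := ⟨f.1.comp π.toContinuousMap, by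
    intro g h
    have := f.2 (π g) (π h)
    rw [← map_mul] at this
    exact this⟩
  map_add' _ _ := rfl
  map_smul' _ _ := rfl

/-! ### Augmented bilinear maps and rigid elements -/

/-- An augmented `𝔽_p`-bilinear map: a bilinear map `A₁ × A₁ → A₂` of `𝔽_p`-linear spaces with a
distinguished `ε ∈ A₁` such that `2ε = 0`. -/
structure AugmentedBilinearMap (p : ℕ) (A₁ : Type u) (A₂ : Type v) [AddCommGroup A₁]
    [AddCommGroup A₂] [Module (ZMod p) A₁] [Module (ZMod p) A₂] where
  toBilin : A₁ →ₗ[ZMod p] A₁ →ₗ[ZMod p] A₂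
  ε : A₁
  two_nsmul_ε : 2 • ε = 0

/-- A nonzero `a` is rigid if `(a, b) = 0` implies that `ε + a` and `b` are linearly dependent. -/
def AugmentedBilinearMap.IsRigid {p : ℕ} {A₁ : Type u} {A₂ : Type v} [AddCommGroup A₁]
    [AddCommGroup A₂] [Module (ZMod p) A₁] [Module (ZMod p) A₂]
    (B : AugmentedBilinearMap p A₁ A₂) (a : A₁) : Prop :=
  a ≠ 0 ∧ ∀ b : A₁, B.toBilin a b = 0 → ¬ LinearIndependent (ZMod p) ![B.ε + a, b]

/-! ### The topology of a semidirect product -/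

section Semidirect

variable {N : Type u} {G : Type v} [Group N] [Group G] [TopologicalSpace N] [TopologicalSpace G]
  {φ : G →* MulAut N}

/-- A semidirect product `N ⋊ G` carries the product topology. -/
instance semidirectProductTopology : TopologicalSpace (N ⋊[φ] G) :=
  TopologicalSpace.induced SemidirectProduct.equivProd inferInstance

theorem continuous_semidirectProduct_left : Continuous fun x : N ⋊[φ] G => x.left :=
  continuous_fst.comp (continuous_induced_dom (f := SemidirectProduct.equivProd))

theorem continuous_semidirectProduct_right : Continuous fun x : N ⋊[φ] G => x.right :=
  continuous_snd.comp (continuous_induced_dom (f := SemidirectProduct.equivProd))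

theorem continuous_semidirectProduct_rng {X : Type*} [TopologicalSpace X] {f : X → N ⋊[φ] G}
    (hl : Continuous fun x => (f x).left) (hr : Continuous fun x => (f x).right) :
    Continuous f :=
  continuous_induced_rng.2 (hl.prodMk hr)

theorem semidirectProduct_isTopologicalGroup [IsTopologicalGroup N] [IsTopologicalGroup G]
    (hφ : Continuous fun x : G × N => φ x.1 x.2) : IsTopologicalGroup (N ⋊[φ] G) where
  continuous_mul := by
    refine continuous_semidirectProduct_rng ?_ ?_
    · have h1 : Continuous fun x : (N ⋊[φ] G) × (N ⋊[φ] G) => x.1.left :=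
        continuous_semidirectProduct_left.comp continuous_fst
      have h2 : Continuous fun x : (N ⋊[φ] G) × (N ⋊[φ] G) => (x.1.right, x.2.left) :=
        (continuous_semidirectProduct_right.comp continuous_fst).prodMk
          (continuous_semidirectProduct_left.comp continuous_snd)
      exact h1.mul (hφ.comp h2)
    · have h1 : Continuous fun x : (N ⋊[φ] G) × (N ⋊[φ] G) => x.1.right :=
        continuous_semidirectProduct_right.comp continuous_fst
      have h2 : Continuous fun x : (N ⋊[φ] G) × (N ⋊[φ] G) => x.2.right :=
        continuous_semidirectProduct_right.comp continuous_snd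
      exact h1.mul h2
  continuous_inv := by
    refine continuous_semidirectProduct_rng ?_ ?_
    · have h : Continuous fun x : N ⋊[φ] G => (x.right⁻¹, x.left⁻¹) :=
        continuous_semidirectProduct_right.inv.prodMk continuous_semidirectProduct_left.inv
      exact hφ.comp h
    · exact continuous_semidirectProduct_right.inv

end Semidirect

/-! ### Cyclotomic pro-`p` pairs -/

theorem zmod_two_add_eq_zero_iff : ∀ s t : ZMod 2, s + t = 0 ↔ (s = 0 ↔ t = 0) := by
  decide

theorem zmod_two_two_nsmul : ∀ s : ZMod 2, 2 • s = 0 := by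
  decide

section Pairs

variable (p : ℕ) [Fact p.Prime]

/-- A cyclotomic pro-`p` pair `(G, θ)`: a pro-`p` group `G` (a profinite group all of whose
quotients by open normal subgroups are `p`-groups) and a continuous homomorphism
`θ : G → 1 + pℤ_p`. -/
structure CyclotomicPair where
  G : ProfiniteGrp.{u}
  isPGroup_quotient : ∀ U : OpenNormalSubgroup G, IsPGroup p (G ⧸ U.toSubgroup)
  θ : G →ₜ* ℤ_[p]ˣ
  dvd_θ_sub_one : ∀ g : G, (p : ℤ_[p]) ∣ (θ g : ℤ_[p]) - 1

variable {p}

theorem isClopen_setOf_pow_dvd_sub_one (n : ℕ) :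
    IsClopen {x : ℤ_[p] | (p : ℤ_[p]) ^ n ∣ x - 1} := by
  have hp : (0 : ℝ) < (p : ℝ) ^ (-(n : ℤ)) :=
    zpow_pos (by exact_mod_cast (Fact.out : p.Prime).pos) _
  have : {x : ℤ_[p] | (p : ℤ_[p]) ^ n ∣ x - 1} = Metric.closedBall 1 ((p : ℝ) ^ (-(n : ℤ))) := by
    ext x
    rw [Set.mem_ofPred_eq, Metric.mem_closedBall, dist_eq_norm,
      PadicInt.norm_le_pow_iff_mem_span_pow, Ideal.mem_span_singleton]
  rw [this]
  exact IsUltrametricDist.isClopen_closedBall _ hp.ne'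

namespace CyclotomicPair

/-- For units of `ℤ_2` which are `1` modulo `2`, lying in `1 + 4ℤ_2` is a character. -/
theorem four_dvd_mul_sub_one_iff (hp : p = 2) (x y : ℤ_[p]) (hx : (p : ℤ_[p]) ∣ x - 1)
    (hy : (p : ℤ_[p]) ∣ y - 1) :
    (4 : ℤ_[p]) ∣ x * y - 1 ↔ ((4 : ℤ_[p]) ∣ x - 1 ↔ (4 : ℤ_[p]) ∣ y - 1) := by
  subst hp
  obtain ⟨a, ha⟩ := hx
  obtain ⟨b, hb⟩ := hy
  have h2 : (2 : ℤ_[2]) ≠ 0 := two_ne_zero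
  have key : ∀ c : ℤ_[2], (4 : ℤ_[2]) ∣ 2 * c ↔ PadicInt.toZMod c = 0 := by
    intro c
    have e : (4 : ℤ_[2]) = 2 * 2 := by norm_num
    rw [e, mul_dvd_mul_iff_left h2, ← RingHom.mem_ker, PadicInt.ker_toZMod,
      PadicInt.maximalIdeal_eq_span_p, Ideal.mem_span_singleton]
    norm_num
  have hx' : x - 1 = 2 * a := by simpa using ha
  have hy' : y - 1 = 2 * b := by simpa using hb
  have hxy : x * y - 1 = 2 * (a + b + 2 * a * b) := by
    linear_combination y * hx' + (1 + 2 * a) * hy'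
  have h20 : (2 : ZMod 2) = 0 := rfl
  rw [hxy, hx', hy', key, key, key, map_add, map_add, map_mul, map_mul, map_ofNat, h20, zero_mul,
    zero_mul, add_zero]
  exact zmod_two_add_eq_zero_iff _ _

/-- The homomorphism `ε_𝒢 : G → ℤ/p`. For `p > 2` it is `0`. For `p = 2` it is `θ` followed by the
projection `1 + 2ℤ_2 = {±1} × (1 + 4ℤ_2) → {±1} ≅ ℤ/2`, whose kernel is `1 + 4ℤ_2`. -/
noncomputable def eps (P : CyclotomicPair.{u} p) : H1 p P.G := by
  classical
  exact ⟨⟨fun g => if p = 2 ∧ ¬ (4 : ℤ_[p]) ∣ (P.θ g : ℤ_[p]) - 1 then 1 else 0, by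
    by_cases hp : p = 2
    · have h4 : (4 : ℤ_[p]) = (p : ℤ_[p]) ^ 2 := by
        subst hp
        norm_num
      have hc : IsClopen {g : P.G | (4 : ℤ_[p]) ∣ (P.θ g : ℤ_[p]) - 1} := by
        rw [h4]
        exact (isClopen_setOf_pow_dvd_sub_one 2).preimage
          (Units.continuous_val.comp P.θ.continuous_toFun)
      simp only [hp, true_and]
      refine Continuous.if (fun a ha => ?_) continuous_const continuous_const
      have := hc.compl.frontier_eq
      exact absurd ha (by
        change a ∉ frontier {g : P.G | (4 : ℤ_[p]) ∣ (P.θ g : ℤ_[p]) - 1}ᶜ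
        rw [this]
        exact Set.notMem_empty a)
    · simp only [hp, false_and, if_false]
      exact continuous_const⟩, by
    intro g h
    by_cases hp : p = 2
    · have h2 : (1 : ZMod p) + 1 = 0 := by
        subst hp
        rfl
      have := four_dvd_mul_sub_one_iff hp _ _ (P.dvd_θ_sub_one g) (P.dvd_θ_sub_one h)
      simp only [ContinuousMap.coe_mk, hp, true_and, map_mul, Units.val_mul, this]
      by_cases h1 : (4 : ℤ_[p]) ∣ (P.θ g : ℤ_[p]) - 1 <;>
        by_cases h3 : (4 : ℤ_[p]) ∣ (P.θ h : ℤ_[p]) - 1 <;> simp [h1, h3, h2]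
    · simp [hp]⟩

theorem two_nsmul_eps (P : CyclotomicPair.{u} p) : 2 • P.eps = 0 := by
  ext g
  by_cases hp : p = 2
  · subst hp
    exact zmod_two_two_nsmul _
  · simp [eps, hp]

/-- The augmented `𝔽_p`-bilinear map associated with a pair: the cup product
`H^1(G) × H^1(G) → H^2(G)` with distinguished element `ε_𝒢`. -/
noncomputable def cupAugmented (P : CyclotomicPair.{u} p) :
    AugmentedBilinearMap p (H1 p P.G) (H2 p P.G) where
  toBilin := cup p P.G
  ε := P.eps
  two_nsmul_ε := P.two_nsmul_eps

/-! ### Extensions -/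

/-- The action of `ḡ` on `A = ℤ_p^L` (written multiplicatively): multiplication by `θ(ḡ)`. -/
noncomputable def action (P : CyclotomicPair.{u} p) (L : Type v) :
    P.G →* MulAut (Multiplicative (L → ℤ_[p])) where
  toFun g := AddEquiv.toMultiplicative (DistribMulAction.toAddEquiv (L → ℤ_[p]) (P.θ g))
  map_one' := by
    ext a
    simp
  map_mul' g h := by
    ext a
    simp [mul_smul]

/-- The group `A ⋊ Ḡ` with `A = ℤ_p^L` and `ḡ a ḡ⁻¹ = θ(ḡ) a`. -/
abbrev ExtGroup (P : CyclotomicPair.{u} p) (L : Type v) : Type (max u v) :=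
  Multiplicative (L → ℤ_[p]) ⋊[P.action L] P.G

variable (P : CyclotomicPair.{u} p) (L : Type v)

/-- The defining homeomorphism of `A ⋊ Ḡ` with `A × Ḡ`. -/
noncomputable def extHomeo :
    P.ExtGroup L ≃ₜ Multiplicative (L → ℤ_[p]) × P.G where
  toEquiv := SemidirectProduct.equivProd
  continuous_toFun := continuous_induced_dom
  continuous_invFun := continuous_induced_rng.2 continuous_id

instance : CompactSpace (P.ExtGroup L) := (P.extHomeo L).symm.compactSpace

instance : TotallyDisconnectedSpace (P.ExtGroup L) :=
  (P.extHomeo L).symm.totallyDisconnectedSpace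

theorem continuous_action :
    Continuous fun x : P.G × Multiplicative (L → ℤ_[p]) => P.action L x.1 x.2 := by
  change Continuous fun x : P.G × Multiplicative (L → ℤ_[p]) =>
    Multiplicative.ofAdd (fun l : L => (P.θ x.1 : ℤ_[p]) * Multiplicative.toAdd x.2 l)
  refine continuous_ofAdd.comp (continuous_pi fun l => ?_)
  refine Continuous.mul ?_ ?_
  · exact Units.continuous_val.comp (P.θ.continuous_toFun.comp continuous_fst)
  · exact (continuous_apply l).comp (continuous_toAdd.comp continuous_snd)

instance : IsTopologicalGroup (P.ExtGroup L) :=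
  semidirectProduct_isTopologicalGroup (P.continuous_action L)

/-- The projection `π : A ⋊ Ḡ → Ḡ`. -/
noncomputable def extProj : P.ExtGroup L →ₜ* P.G where
  toMonoidHom := SemidirectProduct.rightHom
  continuous_toFun := continuous_semidirectProduct_right

theorem isPGroup_quotient_ext (U : OpenNormalSubgroup (P.ExtGroup L)) :
    IsPGroup p (P.ExtGroup L ⧸ U.toSubgroup) := by
  -- `V = U ∩ Ḡ` is an open normal subgroup of `Ḡ`
  have hUo : IsOpen (U : Set (P.ExtGroup L)) := U.toOpenSubgroup.isOpen
  have hinr : Continuous fun g : P.G => (SemidirectProduct.inr g : P.ExtGroup L) :=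
    continuous_semidirectProduct_rng continuous_const continuous_id
  have hinl : Continuous fun a : Multiplicative (L → ℤ_[p]) =>
      (SemidirectProduct.inl a : P.ExtGroup L) :=
    continuous_semidirectProduct_rng continuous_id continuous_const
  let V : OpenNormalSubgroup P.G :=
    { toSubgroup := U.toSubgroup.comap SemidirectProduct.inr
      isOpen' := hUo.preimage hinr
      isNormal' := inferInstance }
  intro q
  obtain ⟨x, rfl⟩ := QuotientGroup.mk_surjective q
  obtain ⟨k, hk⟩ := P.isPGroup_quotient V (QuotientGroup.mk x.right)
  have hkV : (SemidirectProduct.inr (x.right ^ p ^ k) : P.ExtGroup L) ∈ U.toSubgroup := by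
    rw [← QuotientGroup.mk_pow, QuotientGroup.eq_one_iff] at hk
    exact hk
  -- `x ^ p ^ k` is congruent modulo `U` to an element of `A`
  set y := x ^ p ^ k with hy
  have hyr : y.right = x.right ^ p ^ k :=
    map_pow (SemidirectProduct.rightHom : P.ExtGroup L →* P.G) x (p ^ k)
  have hyl : (QuotientGroup.mk y : P.ExtGroup L ⧸ U.toSubgroup) =
      QuotientGroup.mk (SemidirectProduct.inl y.left) := by
    conv_lhs =>
      rw [← SemidirectProduct.inl_left_mul_inr_right y, QuotientGroup.mk_mul, hyr,
        (QuotientGroup.eq_one_iff _).2 hkV, mul_one]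
  -- `p ^ n a` tends to `0` in `A`
  have hlim : Filter.Tendsto (fun n : ℕ => y.left ^ p ^ n) Filter.atTop (nhds 1) := by
    have hl : Filter.Tendsto
        (fun n : ℕ => fun l : L => (p : ℤ_[p]) ^ n * Multiplicative.toAdd y.left l)
        Filter.atTop (nhds 0) := by
      rw [tendsto_pi_nhds]
      intro l
      have h0 : Filter.Tendsto (fun n : ℕ => (p : ℤ_[p]) ^ n) Filter.atTop (nhds 0) :=
        tendsto_pow_atTop_nhds_zero_of_norm_lt_one
          (PadicInt.mem_nonunits.1 PadicInt.p_nonunit)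
      simpa using h0.mul_const (Multiplicative.toAdd y.left l)
    refine Filter.Tendsto.congr (fun n => ?_) hl
    change _ = p ^ n • Multiplicative.toAdd y.left
    ext l
    simp
  have hev : ∀ᶠ n : ℕ in Filter.atTop,
      (SemidirectProduct.inl (y.left ^ p ^ n) : P.ExtGroup L) ∈ U.toSubgroup := by
    refine hlim.eventually ((hUo.preimage hinl).mem_nhds ?_)
    change (SemidirectProduct.inl 1 : P.ExtGroup L) ∈ U.toSubgroup
    rw [map_one]
    exact U.toSubgroup.one_mem
  obtain ⟨n, hn⟩ := hev.exists
  refine ⟨k + n, ?_⟩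
  rw [pow_add, pow_mul, ← QuotientGroup.mk_pow, ← hy, hyl, ← QuotientGroup.mk_pow, ← map_pow]
  exact (QuotientGroup.eq_one_iff _).2 hn

/-- The extension `A ⋊ 𝒢̄` of the pair `𝒢̄` by `A = ℤ_p^L`, with character `θ̄ ∘ π`. -/
noncomputable def extension : CyclotomicPair.{max u v} p where
  G := ProfiniteGrp.of (P.ExtGroup L)
  isPGroup_quotient := P.isPGroup_quotient_ext L
  θ := P.θ.comp (P.extProj L)
  dvd_θ_sub_one _ := P.dvd_θ_sub_one _

/-- Inflation `inf : H^1(Ḡ) → H^1(G)` for `𝒢 = A ⋊ 𝒢̄`. -/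
noncomputable def extInf : H1 p P.G →ₗ[ZMod p] H1 p (P.extension L).G :=
  inflation p (P.extProj L)

end CyclotomicPair

end Pairs

/-! Since `φ` is not inflated, it is nonzero at some `a` in the kernel `A`. If `φ ∪ ψ` is the
coboundary of a cochain `c`, the relation `g a = (θ(g) a) g` can be tested on `c`. Writing `θ(g) = 1
+ p t`, the values of `c` cancel up to one term (`cup_primitive_commutator`): `φ(a) ψ(g) = φ(g) ψ(a)
+ c(p t a)`. The remaining term is the value of `c` on a `p`-th power, which is `-(p choose 2) φ(t
a) ψ(t a)` by `cup_primitive_pow`. It vanishes for odd `p`. For `p = 2` it is `φ(a) ψ(a)` or `0`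
according to the parity of `t`, that is, `ε(g) φ(a) ψ(a)`; this is where `ε` comes from
(`cup_primitive_extKer_pow`). Dividing by `φ(a)` gives `ψ = (ψ(a)/φ(a)) (φ + ε)`. -/

theorem zmod_eq_one_of_ne_zero {p : ℕ} (hp : p = 2) (z : ZMod p) (hz : z ≠ 0) : z = 1 := by
  subst hp
  revert z
  decide

/-! ### Primitives of cup products on powers. -/

section CupProductPowers

variable {p : ℕ} {G : Type*} [Group G] {φ ψ c : G → ZMod p}

theorem additive_map_one (hφ : ∀ g h, φ (g * h) = φ g + φ h) : φ 1 = 0 := by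
  simpa using hφ 1 1

theorem additive_map_pow (hφ : ∀ g h, φ (g * h) = φ g + φ h) (x : G) (n : ℕ) :
    φ (x ^ n) = n * φ x := by
  induction n with
  | zero => simp [additive_map_one hφ]
  | succ n ih =>
    rw [pow_succ, hφ, ih]
    push_cast
    ring

/-- The values on powers of a cochain whose coboundary is `φ ∪ ψ`. -/
theorem cup_primitive_pow (hφ : ∀ g h, φ (g * h) = φ g + φ h)
    (hc : ∀ g h, c h - c (g * h) + c g = φ g * ψ h) (x : G) (n : ℕ) :
    c (x ^ n) = n * c x - n.choose 2 * (φ x * ψ x) := by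
  induction n with
  | zero =>
    have h := hc 1 1
    rw [additive_map_one hφ, mul_one] at h
    simpa using h
  | succ n ih =>
    -- This pair contributes `n φ(x) ψ(x)`, the increment `n choose 1` in Pascal's rule.
    have h := hc (x ^ n) x
    rw [← pow_succ, additive_map_pow hφ] at h
    rw [Nat.choose_succ_succ' n 1, Nat.choose_one_right]
    push_cast
    linear_combination -h + ih

/-- An odd prime `p` divides `p choose 2`, so both terms of `cup_primitive_pow` vanish. -/
theorem cup_primitive_pow_of_ne_two [Fact p.Prime] (hp : p ≠ 2)
    (hφ : ∀ g h, φ (g * h) = φ g + φ h)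
    (hc : ∀ g h, c h - c (g * h) + c g = φ g * ψ h) (x : G) : c (x ^ p) = 0 := by
  have hpr : p.Prime := Fact.out
  have h : ((p.choose 2 : ℕ) : ZMod p) = 0 :=
    (ZMod.natCast_eq_zero_iff _ _).2
      (hpr.dvd_choose_self two_ne_zero (lt_of_le_of_ne hpr.two_le hp.symm))
  simp [cup_primitive_pow hφ hc, h]

end CupProductPowers

/-! ### The kernel `A` and its commutators in `A ⋊ Ḡ`. -/

namespace CyclotomicPair

variable {p : ℕ} [Fact p.Prime] (P : CyclotomicPair.{u} p) (L : Type v)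

/-- The inclusion `A → A ⋊ Ḡ` of the kernel, with `A` written additively. -/
noncomputable def extKer (a : L → ℤ_[p]) : P.ExtGroup L := SemidirectProduct.inl (Multiplicative.ofAdd a)

theorem extKer_add (a b : L → ℤ_[p]) :
    P.extKer L (a + b) = P.extKer L a * P.extKer L b := by
  simp [extKer]

theorem extKer_natCast_smul (n : ℕ) (a : L → ℤ_[p]) :
    P.extKer L ((n : ℤ_[p]) • a) = P.extKer L a ^ n := by
  rw [Nat.cast_smul_eq_nsmul, extKer, ofAdd_nsmul, map_pow]
  rfl

theorem mul_extKer (g : P.ExtGroup L) (a : L → ℤ_[p]) :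
    g * P.extKer L a = P.extKer L ((P.θ g.right : ℤ_[p]) • a) * g := by
  refine SemidirectProduct.ext ?_ ?_
  · rw [SemidirectProduct.mul_left, SemidirectProduct.mul_left, mul_comm]
    simp only [extKer, SemidirectProduct.left_inl, SemidirectProduct.right_inl, map_one,
      MulAut.one_apply]
    rfl
  · simp [extKer]

variable {P L}

/-- A character trivial on `A` is the inflation of its restriction along the section `Ḡ → A ⋊ Ḡ`. -/
theorem exists_extKer_ne_zero {φ : H1 p (P.extension L).G}
    (hφ : φ ∉ LinearMap.range (P.extInf L)) :
    ∃ a : L → ℤ_[p], φ.1 (P.extKer L a : P.ExtGroup L) ≠ 0 := by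
  by_contra! h
  have hinr : Continuous fun g : P.G => (SemidirectProduct.inr g : P.ExtGroup L) :=
    continuous_semidirectProduct_rng continuous_const continuous_id
  refine hφ ⟨⟨φ.1.comp ⟨fun g => (SemidirectProduct.inr g : P.ExtGroup L), hinr⟩,
    fun g k => ?_⟩, ?_⟩
  · change φ.1 (SemidirectProduct.inr (g * k) : P.ExtGroup L) = _
    rw [map_mul]
    exact φ.2 _ _
  · ext x
    change P.ExtGroup L at x
    have h1 := φ.2 (P.extKer L (Multiplicative.toAdd x.left))
      (SemidirectProduct.inr x.right : P.ExtGroup L)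
    rw [h, zero_add] at h1
    refine h1.symm.trans (congrArg φ.1 ?_)
    exact SemidirectProduct.inl_left_mul_inr_right x

variable {φ ψ c : P.ExtGroup L → ZMod p}

theorem additive_map_extKer_p_smul (hφ : ∀ g h, φ (g * h) = φ g + φ h) (a : L → ℤ_[p]) :
    φ (P.extKer L ((p : ℤ_[p]) • a)) = 0 := by
  rw [extKer_natCast_smul, additive_map_pow hφ]
  simp

/-- A cochain with coboundary `φ ∪ ψ`, evaluated on the commutators of `A ⋊ Ḡ` with `A`. -/
theorem cup_primitive_commutator (hφ : ∀ g h, φ (g * h) = φ g + φ h)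
    (hψ : ∀ g h, ψ (g * h) = ψ g + ψ h)
    (hc : ∀ g h, c h - c (g * h) + c g = φ g * ψ h) (g : P.ExtGroup L) (a : L → ℤ_[p])
    (t : ℤ_[p]) (ht : (P.θ g.right : ℤ_[p]) - 1 = p * t) :
    φ (P.extKer L a) * ψ g = φ g * ψ (P.extKer L a) + c (P.extKer L (t • a) ^ p) := by
  have hθ : (P.θ g.right : ℤ_[p]) • a = a + (p : ℤ_[p]) • t • a := by
    rw [sub_eq_iff_eq_add.1 ht, add_smul, one_smul, mul_smul, add_comm]
  -- `h1` and `h2` evaluate `c` on the two factorizations of `g a`; `h3` splits `θ(g) a` as `a + p t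
  -- a`. The right side of `h3` is zero because `ψ` kills `pA`.
  have h1 := hc g (P.extKer L a)
  have h2 := hc (P.extKer L ((P.θ g.right : ℤ_[p]) • a)) g
  have h3 := hc (P.extKer L a) (P.extKer L ((p : ℤ_[p]) • t • a))
  rw [mul_extKer] at h1
  rw [← extKer_add, additive_map_extKer_p_smul hψ, ← hθ] at h3
  rw [hθ, extKer_add, hφ, additive_map_extKer_p_smul hφ, ← extKer_add, ← hθ] at h2
  rw [← extKer_natCast_smul]
  linear_combination h1 - h2 - h3

open Classical in
/-- For `p = 2`, an additive map on `A` is semilinear along `ℤ_2 → ℤ/2`. -/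
theorem additive_map_extKer_smul_of_eq_two (hp : p = 2) (hφ : ∀ g h, φ (g * h) = φ g + φ h)
    (t : ℤ_[p]) (a : L → ℤ_[p]) :
    φ (P.extKer L (t • a)) = if (p : ℤ_[p]) ∣ t then 0 else φ (P.extKer L a) := by
  split_ifs with h
  · obtain ⟨s, rfl⟩ := h
    rw [mul_smul, additive_map_extKer_p_smul hφ]
  · have h1 : (p : ℤ_[p]) ∣ t - 1 := by
      rw [← Ideal.mem_span_singleton, ← PadicInt.maximalIdeal_eq_span_p, ← PadicInt.ker_toZMod,
        RingHom.mem_ker] at h ⊢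
      rw [map_sub, map_one, zmod_eq_one_of_ne_zero hp _ h, sub_self]
    obtain ⟨s, hs⟩ := h1
    rw [sub_eq_iff_eq_add.1 hs, add_smul, mul_smul, one_smul, extKer_add, hφ,
      additive_map_extKer_p_smul hφ, zero_add]

-- For `p = 2` the sign of `θ(g)` is read off from the parity of `t`, as `4 ∣ 2t` exactly when `2 ∣
-- t`; the same parity decides whether `φ` and `ψ` vanish on `t a` or agree there with their values
-- at `a`.
open Classical in
theorem cup_primitive_extKer_pow (hφ : ∀ g h, φ (g * h) = φ g + φ h)
    (hψ : ∀ g h, ψ (g * h) = ψ g + ψ h)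
    (hc : ∀ g h, c h - c (g * h) + c g = φ g * ψ h) (g : P.ExtGroup L) (a : L → ℤ_[p])
    (t : ℤ_[p]) (ht : (P.θ g.right : ℤ_[p]) - 1 = p * t) :
    c (P.extKer L (t • a) ^ p) =
      (if p = 2 ∧ ¬ (4 : ℤ_[p]) ∣ (P.θ g.right : ℤ_[p]) - 1 then 1 else 0) *
        (φ (P.extKer L a) * ψ (P.extKer L a)) := by
  by_cases hp : p = 2
  · have h4 : (4 : ℤ_[p]) ∣ (P.θ g.right : ℤ_[p]) - 1 ↔ (p : ℤ_[p]) ∣ t := by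
      have e : (4 : ℤ_[p]) = p * p := by
        subst hp
        norm_num
      rw [ht, e, mul_dvd_mul_iff_left (Nat.cast_ne_zero.2 (Fact.out : p.Prime).ne_zero)]
    -- `2 choose 2 = 1 = -1` modulo `2`; this form absorbs the sign in `cup_primitive_pow`.
    have hch : ((p.choose 2 : ℕ) : ZMod p) = -1 := by
      subst hp
      rfl
    rw [cup_primitive_pow hφ hc, hch, CharP.cast_eq_zero,
      additive_map_extKer_smul_of_eq_two hp hφ, additive_map_extKer_smul_of_eq_two hp hψ, h4]
    by_cases h : (p : ℤ_[p]) ∣ t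
    · rw [if_pos h, if_pos h, if_neg fun h' => h'.2 h]
      ring
    · rw [if_neg h, if_neg h, if_pos ⟨hp, h⟩]
      ring
  · simp [cup_primitive_pow_of_ne_two hp hφ hc, hp]

theorem exists_eq_smul_of_cup_eq_zero {φ : H1 p (P.extension L).G}
    (hφ : φ ∉ LinearMap.range (P.extInf L)) {ψ : H1 p (P.extension L).G}
    (h : cup p (P.extension L).G φ ψ = 0) :
    ∃ c : ZMod p, ψ = c • (φ + (P.extension L).eps) := by
  classical
  obtain ⟨a, ha⟩ := exists_extKer_ne_zero hφ
  obtain ⟨c, hc⟩ := (Submodule.Quotient.mk_eq_zero _).1 h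
  have hc' : ∀ g k : P.ExtGroup L, c k - c (g * k) + c g = φ.1 g * ψ.1 k := fun g k =>
    DFunLike.congr_fun (congrArg Subtype.val hc) (g, k)
  refine ⟨ψ.1 (P.extKer L a : P.ExtGroup L) / φ.1 (P.extKer L a : P.ExtGroup L), ?_⟩
  ext g
  change P.ExtGroup L at g
  obtain ⟨t, ht⟩ := P.dvd_θ_sub_one g.right
  have h1 := cup_primitive_commutator φ.2 ψ.2 hc' g a t ht
  have h2 := cup_primitive_extKer_pow φ.2 ψ.2 hc' g a t ht
  have h3 : (P.extension L).eps.1 g =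
      if p = 2 ∧ ¬ (4 : ℤ_[p]) ∣ (P.θ g.right : ℤ_[p]) - 1 then 1 else 0 := by
    unfold eps
    rfl
  change ψ.1 g = _ * (φ.1 g + (P.extension L).eps.1 g)
  -- The factor `φ(a)` beside `ε(g)` is harmless: it equals `1` for `p = 2`, and `ε = 0` otherwise.
  have h4 : (P.extension L).eps.1 g * φ.1 (P.extKer L a : P.ExtGroup L) =
      (P.extension L).eps.1 g := by
    by_cases hp : p = 2
    · rw [zmod_eq_one_of_ne_zero hp _ ha, mul_one]
    · simp [h3, hp]
  rw [h2, ← h3] at h1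
  rw [div_mul_eq_mul_div, eq_div_iff ha]
  linear_combination h1 + ψ.1 (P.extKer L a : P.ExtGroup L) * h4

end CyclotomicPair

theorem mainTheorem7 (p : ℕ) [Fact p.Prime] (P : CyclotomicPair.{u} p) (L : Type v)
    (φ : H1 p (P.extension L).G) (hφ : φ ∉ LinearMap.range (P.extInf L)) :
    (P.extension L).cupAugmented.IsRigid φ ∧
      ∀ ψ : H1 p (P.extension L).G, cup p (P.extension L).G φ ψ = 0 →
        ∃ c : ZMod p, ψ = c • (φ + (P.extension L).eps) := by
  refine ⟨⟨fun h => hφ (h ▸ Submodule.zero_mem _), fun ψ hψ hli => ?_⟩,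
    fun ψ hψ => CyclotomicPair.exists_eq_smul_of_cup_eq_zero hφ hψ⟩
  obtain ⟨c, hc⟩ := CyclotomicPair.exists_eq_smul_of_cup_eq_zero hφ hψ
  rw [LinearIndependent.pair_iff] at hli
  -- The coefficient `-1` of `ψ` is nonzero, so the relation is nontrivial even when `c = 0`.
  have h := (hli c (-1) ?_).2
  · exact one_ne_zero (neg_eq_zero.1 h)
  · change c • ((P.extension L).eps + φ) + (-1 : ZMod p) • ψ = 0
    rw [hc]
    module
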